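/- All graphs are finite, simple and undirected. A tree decomposition of a graph $G=(V,E)$ is a finite tree $T$ whose nodes are subsets of $V$, called bags, such that every vertex lies in some bag, every edge of $G$ has both ends in some common bag, and for every $v\in V$ the bags containing $v$ induce a subtree of $T$. Its width is the maximum size of a bag minus $1$; the treewidth of $G$ is the minimum width of a tree decomposition of $G$, and a tree decomposition is optimal if its width equals the treewidth of $G$. A $2$-tree is a graph of treewidth $2$ such that adding any edge between two non-adjacent vertices increases the treewidth; a partial $2$-tree is a subgraph of a $2$-tree. In a rooted tree decomposition, every link (edge of $T$) is written $(X,Y)$, where the father $X$ is closer to the root than the child $Y$, and is labelled by $X\cap Y$. An optimal rooted tree decomposition is suitable if every bag has exactly $3$ elements, any two adjacent bags $X,Y$ satisfy $|X\cap Y|=2$, and any two links $(X_1,Y_1)$, $(X_2,Y_2)$ with the same label $X_1\cap Y_1=X_2\cap Y_2$ have the same father, $X_1=X_2$. A graph is outerplanar if it can be drawn in the plane without crossings (vertices as distinct points, edges as simple arcs) so that all vertices lie on the boundary of the outer (unbounded) face. Corollary. Let $G=(V,E)$ be a partial $2$-tree that is $2$-connected (that is, $|V|\ge 3$ and $G$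 is connected and remains connected after the deletion of any single vertex), and let $T$ be a suitable tree decomposition of $G$. Then $G$ is outerplanar if and only if for every two distinct vertices $u,v\in V$ at most two bags of $T$ contain both $u$ and $v$. -/

import Mathlib

namespace SimpleGraph

/-- `G` is `k`-connected: it has more than `k` vertices, and deleting fewer than `k` vertices
leaves a connected graph. -/
def IsKVertexConnected {V : Type*} (G : SimpleGraph V) [Fintype V] (k : ℕ) : Prop :=
  k < Fintype.card V ∧
    ∀ X : Finset V, X.card < k → (G.induce ((X : Set V)ᶜ)).Connected

/-- A tree decomposition of `G`: a tree on the index type `ι` whose node `i` carries the bag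
`bag i`. -/
structure TreeDecomposition {V : Type*} (G : SimpleGraph V) (ι : Type*) where
  bag : ι → Finset V
  tree : SimpleGraph ι
  isTree : tree.IsTree
  cover : ∀ v : V, ∃ i, v ∈ bag i
  edge_cover : ∀ u v : V, G.Adj u v → ∃ i, u ∈ bag i ∧ v ∈ bag i
  subtree : ∀ v : V, (tree.induce {i | v ∈ bag i}).Connected

/-- The treewidth of a tree decomposition: the largest size of a bag, minus one. -/
def TreeDecomposition.width {V : Type*} {G : SimpleGraph V} {ι : Type*} [Fintype ι]
    (T : TreeDecomposition G ι) : ℕ :=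
  (Finset.univ.sup fun i => (T.bag i).card) - 1

/-- The treewidth of a finite graph: the least width of a finite tree decomposition. -/
noncomputable def treewidth {V : Type*} (G : SimpleGraph V) : ℕ :=
  sInf {w : ℕ | ∃ (r : ℕ) (T : TreeDecomposition G (Fin r)), T.width = w}

/-- A `k`-tree: a graph of treewidth `k` such that adding any edge between non-adjacent vertices
increases the treewidth. -/
def IsKTree {V : Type*} (G : SimpleGraph V) (k : ℕ) : Prop :=
  G.treewidth = k ∧ ∀ u v : V, u ≠ v → ¬ G.Adj u v → k < (G ⊔ edge u v).treewidth

/-- A partial `k`-tree: a graph that is (isomorphic to) a subgraph of a finite `k`-tree. -/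
def IsPartialKTree {V : Type*} (G : SimpleGraph V) (k : ℕ) : Prop :=
  ∃ (n : ℕ) (H : SimpleGraph (Fin n)), H.IsKTree k ∧ G ⊑ H

/-- A tree decomposition with a distinguished root. -/
structure RootedTreeDecomposition {V : Type*} (G : SimpleGraph V) (ι : Type*)
    extends TreeDecomposition G ι where
  root : ι

/-- `T.IsLink i j`: there is a link between `i` and `j`, directed from the father `i` (which is
nearer to the root) to the child `j`. -/
def RootedTreeDecomposition.IsLink {V : Type*} {G : SimpleGraph V} {ι : Type*}
    (T : RootedTreeDecomposition G ι) (i j : ι) : Prop :=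
  T.tree.Adj i j ∧ T.tree.dist T.root i < T.tree.dist T.root j

/-- Suitable tree decompositions. -/
structure RootedTreeDecomposition.IsSuitable {V : Type*} [DecidableEq V] {G : SimpleGraph V}
    {ι : Type*} [Fintype ι] (T : RootedTreeDecomposition G ι) : Prop where
  optimal : T.width = G.treewidth
  card_bag : ∀ i, (T.bag i).card = 3
  card_inter : ∀ i j, T.tree.Adj i j → (T.bag i ∩ T.bag j).card = 2
  common_father : ∀ i₁ j₁ i₂ j₂, T.IsLink i₁ j₁ → T.IsLink i₂ j₂ →
    T.bag i₁ ∩ T.bag j₁ = T.bag i₂ ∩ T.bag j₂ → i₁ = i₂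

/-- A drawing of `G` in the Euclidean plane without crossings: distinct vertices are distinct
points, every edge is a simple arc joining its ends and containing no other vertex, and two
different edges meet only in common ends. (The values of `arc` outside the edge set of `G` play no
role.) -/
structure PlaneDrawing {V : Type*} (G : SimpleGraph V) where
  point : V → EuclideanSpace ℝ (Fin 2)
  point_injective : Function.Injective point
  arc : Sym2 V → Set (EuclideanSpace ℝ (Fin 2))
  isArc : ∀ u v : V, G.Adj u v → ∃ γ : unitInterval → EuclideanSpace ℝ (Fin 2),
    Continuous γ ∧ Function.Injective γ ∧ γ 0 = point u ∧ γ 1 = point v ∧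
      Set.range γ = arc s(u, v)
  mem_of_point_mem_arc : ∀ e ∈ G.edgeSet, ∀ w : V, point w ∈ arc e → w ∈ e
  arc_inter_arc : ∀ e ∈ G.edgeSet, ∀ f ∈ G.edgeSet, e ≠ f →
    arc e ∩ arc f ⊆ point '' {w | w ∈ e ∧ w ∈ f}

/-- The set of points of the plane that are covered by the drawing. -/
def PlaneDrawing.carrier {V : Type*} {G : SimpleGraph V} (D : PlaneDrawing G) :
    Set (EuclideanSpace ℝ (Fin 2)) :=
  Set.range D.point ∪ ⋃ e ∈ G.edgeSet, D.arc e

/-- `F` is an outer face of the drawing, that is, an unbounded connected component of the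
complement of the drawing. (A drawing of a finite graph has exactly one.) -/
def PlaneDrawing.IsOuterFace {V : Type*} {G : SimpleGraph V} (D : PlaneDrawing G)
    (F : Set (EuclideanSpace ℝ (Fin 2))) : Prop :=
  (∃ p ∈ D.carrierᶜ, F = connectedComponentIn D.carrierᶜ p) ∧ ¬ Bornology.IsBounded F

/-- `G` is outerplanar: it has a drawing in the plane without crossings in which all vertices lie
on the boundary of the outer face. -/
def IsOuterplanar {V : Type*} (G : SimpleGraph V) : Prop :=
  ∃ (D : PlaneDrawing G) (F : Set (EuclideanSpace ℝ (Fin 2))),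
    D.IsOuterFace F ∧ ∀ v : V, D.point v ∈ frontier F

end SimpleGraph

/-! Suppose three bags contain `u` and `v`. Any two of them are separated by a link whose label is
exactly `{u, v}`, so their third vertices lie in three different components of `G` minus `u` and
`v`. By 2-connectivity each component is attached to both `u` and `v`. If all vertices lay on the
boundary of the outer face, a point `z` of that face could also be joined to the three third
vertices, and `u`, `v`, `z` against these vertices would give a plane drawing of `K₃,₃`
(`not_forall_mem_frontier_of_three_branches`). Winding numbers exclude this in
`not_exists_planar_K33`.

Conversely, if no pair lies in three bags, adding the bags in order of distance from the root glues
each new triangle onto a free side of a triangulated polygon. `exists_isLayout` cuts the cyclic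
order of the polygon open into an order on a line in which no two pairs sharing a bag interleave.
With the vertices placed in this order on a parabola, edges become chords that do not cross, and the
region below the parabola touches every vertex. -/

open Complex in
/-- The increment over `[0, 1]` of a continuous logarithm of `f`. -/
noncomputable def logIncrement (f : ℝ → ℂ) : ℂ :=
  open Classical in
  if h : ∃ L : ℝ → ℂ, Continuous L ∧ ∀ t, exp (L t) = f t then h.choose 1 - h.choose 0 else 0

/-! ### Continuous logarithms and the non-planarity of `K₃,₃`. -/

section LogIncrement

open Complex

theorem exists_continuous_log {A : Type*} [TopologicalSpace A] [SimplyConnectedSpace A]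
    [LocallyPathConnectedSpace A] {f : A → ℂ} (hf : Continuous f) (h0 : ∀ a, f a ≠ 0) :
    ∃ L : A → ℂ, Continuous L ∧ ∀ a, exp (L a) = f a := by
  obtain ⟨a₀⟩ : Nonempty A := inferInstance
  obtain ⟨F, ⟨-, hF⟩, -⟩ := isCoveringMapOn_exp.existsUnique_continuousMap_lifts
    ⟨f, hf⟩ (a₀ := a₀) (e₀ := log (f a₀)) (exp_log (h0 a₀)) (fun a => h0 a)
  exact ⟨F, F.continuous, fun a => congrFun hF a⟩

/-- Up to a constant, `L - M` is a continuous integer multiple of `2πi`, hence constant. The factor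
`c` makes increments insensitive to rescaling, in particular to sign. -/
theorem sub_eq_sub_of_exp_eq_mul_exp {L M : ℝ → ℂ} (hL : Continuous L) (hM : Continuous M) {c : ℂ}
    (h : ∀ t, exp (L t) = c * exp (M t)) : L 1 - L 0 = M 1 - M 0 := by
  have hc : c ≠ 0 := by
    rintro rfl
    exact exp_ne_zero (L 0) (by simpa using h 0)
  obtain ⟨d, rfl⟩ : ∃ d, exp d = c := ⟨log c, exp_log hc⟩
  have key : ∀ t, ∃ n : ℤ, L t = d + M t + n * (2 * Real.pi * I) := fun t =>
    exp_eq_exp_iff_exists_int.1 (by rw [h t, exp_add])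
  choose n hn using key
  have hpi : (2 * Real.pi : ℂ) ≠ 0 := by simp [Real.pi_ne_zero]
  have hcont : Continuous fun t => ((n t : ℤ) : ℝ) := by
    have : (fun t => ((n t : ℤ) : ℝ)) = fun t => ((L t - d - M t) / (2 * Real.pi * I)).re := by
      funext t
      have : (L t - d - M t) / (2 * Real.pi * I) = ((n t : ℝ) : ℂ) := by
        rw [hn t]
        field_simp
        push_cast
        ring
      rw [this, ofReal_re]
    rw [this]
    fun_prop
  have hcont' : Continuous n := Int.isClosedEmbedding_coe_real.isInducing.continuous_iff.2 hcont
  have := PreconnectedSpace.constant (inferInstance : PreconnectedSpace ℝ) hcont' (x := 0) (y := 1)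
  rw [hn 1, hn 0, this]
  ring

theorem logIncrement_eq {f L : ℝ → ℂ} (hL : Continuous L) {c : ℂ}
    (hc : c ≠ 0) (h : ∀ t, exp (L t) = c * f t) : logIncrement f = L 1 - L 0 := by
  have hex : ∃ L : ℝ → ℂ, Continuous L ∧ ∀ t, exp (L t) = f t :=
    ⟨fun t => L t - log c, by fun_prop, fun t => by
      rw [exp_sub, h t, exp_log hc, mul_div_cancel_left₀ _ hc]⟩
  rw [logIncrement, dif_pos hex]
  exact (sub_eq_sub_of_exp_eq_mul_exp hL hex.choose_spec.1
    fun t => by rw [h t, hex.choose_spec.2]).symm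

theorem exp_logIncrement {f : ℝ → ℂ} (hf : Continuous f) (h0 : ∀ t, f t ≠ 0) :
    exp (logIncrement f) = f 1 / f 0 := by
  obtain ⟨L, hL, h⟩ := exists_continuous_log hf h0
  rw [logIncrement_eq hL one_ne_zero (by simpa using h), exp_sub, h, h]

theorem logIncrement_neg {f g : ℝ → ℂ} (hf : Continuous f) (h0 : ∀ t, f t ≠ 0)
    (hg : ∀ t, g t = - f t) : logIncrement g = logIncrement f := by
  obtain ⟨L, hL, h⟩ := exists_continuous_log hf h0
  rw [logIncrement_eq (f := f) hL one_ne_zero (by simpa using h),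
    logIncrement_eq hL (c := -1) (by norm_num) (f := g) (by simpa [hg] using h)]

/-- A nowhere vanishing function on a square has winding number zero along its boundary. -/
theorem logIncrement_square {g : ℝ × ℝ → ℂ} (hg : Continuous g) (h0 : ∀ x, g x ≠ 0) :
    logIncrement (fun s => g (s, 0)) + logIncrement (fun t => g (1, t)) =
      logIncrement (fun t => g (0, t)) + logIncrement (fun s => g (s, 1)) := by
  obtain ⟨L, hL, h⟩ := exists_continuous_log hg h0
  rw [logIncrement_eq (L := fun s => L (s, 0)) (by fun_prop) one_ne_zero (by simp [h]),
    logIncrement_eq (L := fun t => L (1, t)) (by fun_prop) one_ne_zero (by simp [h]),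
    logIncrement_eq (L := fun t => L (0, t)) (by fun_prop) one_ne_zero (by simp [h]),
    logIncrement_eq (L := fun s => L (s, 1)) (by fun_prop) one_ne_zero (by simp [h])]
  ring

/-- `K₃,₃` has no drawing in the plane in which independent edges are disjoint. -/
theorem not_exists_planar_K33 (p w : Fin 3 → ℂ) (γ : Fin 3 → Fin 3 → ℝ → ℂ)
    (hγ : ∀ i j, Continuous (γ i j)) (h0 : ∀ i j, γ i j 0 = p i) (h1 : ∀ i j, γ i j 1 = w j)
    (hdisj : ∀ i k j l, i ≠ k → j ≠ l → ∀ s t, γ i j s ≠ γ k l t) : False := by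
  have hp : ∀ i j k, i ≠ k → ∀ t, γ i j t - p k ≠ 0 := fun i j k hik t => by
    -- `p k` is an end of some edge `k l` with `l ≠ j`, which is independent of the edge `i j`.
    obtain ⟨l, hl⟩ := exists_ne j
    rw [← h0 k l]
    exact sub_ne_zero.2 (hdisj i k j l hik hl.symm t 0)
  have hw : ∀ i j l, j ≠ l → ∀ t, γ i j t - w l ≠ 0 := fun i j l hjl t => by
    obtain ⟨k, hk⟩ := exists_ne i
    rw [← h1 k l]
    exact sub_ne_zero.2 (hdisj i k j l hk.symm hjl t 1)
  obtain ⟨P, hP⟩ : ∃ P : Fin 3 → Fin 3 → Fin 3 → ℂ,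
      ∀ k i j, P k i j = logIncrement (fun t => γ i j t - p k) := ⟨_, fun _ _ _ => rfl⟩
  obtain ⟨W, hW⟩ : ∃ W : Fin 3 → Fin 3 → Fin 3 → ℂ,
      ∀ l i j, W l i j = logIncrement (fun t => γ i j t - w l) := ⟨_, fun _ _ _ => rfl⟩
  have hexpP : ∀ k i j, i ≠ k → exp (P k i j) = (w j - p k) / (p i - p k) := fun k i j hik => by
    have := hγ i j
    rw [hP, exp_logIncrement (by fun_prop) (hp i j k hik), h0, h1]
  have hexpW : ∀ l i j, j ≠ l → exp (W l i j) = (w j - w l) / (p i - w l) := fun l i j hjl => by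
    have := hγ i j
    rw [hW, exp_logIncrement (by fun_prop) (hw i j l hjl), h0, h1]
  have hpp : ∀ i k, i ≠ k → p i - p k ≠ 0 := fun i k hik => by
    simpa [h0] using hp i 0 k hik 0
  have hww : ∀ j l, j ≠ l → w j - w l ≠ 0 := fun j l hjl => by
    simpa [h1] using hw 0 j l hjl 1
  have hwp : ∀ j k, w j - p k ≠ 0 := fun j k => by
    obtain ⟨i, hi⟩ := exists_ne k
    simpa [h1] using hp i j k hi 1
  -- The difference `γ i j s - γ k l t` never vanishes on the square; its four sides give the four
  -- increments.
  have E : ∀ i k j l, i ≠ k → j ≠ l → P k i j + W j k l = P i k l + W l i j := by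
    intro i k j l hik hjl
    have hc := hγ i j
    have hc' := hγ k l
    have := logIncrement_square (g := fun x => γ i j x.1 - γ k l x.2) (by fun_prop)
      (fun x => sub_ne_zero.2 (hdisj i k j l hik hjl _ _))
    simp only [h0, h1] at this
    rw [logIncrement_neg (f := fun t => γ k l t - w j) (g := fun t => w j - γ k l t) (by fun_prop)
      (hw k l j hjl.symm) (by simp), logIncrement_neg (f := fun t => γ k l t - p i)
      (g := fun t => p i - γ k l t) (by fun_prop) (hp k l i hik.symm) (by simp)] at this
    simpa [hP, hW] using this
  -- Sum `E` over `i < k` and ordered pairs `j ≠ l`. Every surviving term occurs twice, and the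
  -- terms `W l 1 j` cancel.
  have key : ∑ j, (P 1 0 j + P 2 0 j + P 2 1 j) +
      (W 0 2 1 + W 0 2 2 + W 1 2 0 + W 1 2 2 + W 2 2 0 + W 2 2 1) =
      ∑ j, (P 0 1 j + P 0 2 j + P 1 2 j) +
      (W 0 0 1 + W 0 0 2 + W 1 0 0 + W 1 0 2 + W 2 0 0 + W 2 0 1) := by
    simp only [Fin.sum_univ_three]
    have e := fun i k (h : i ≠ k) => And.intro (E i k 0 1 h (by decide))
      (And.intro (E i k 0 2 h (by decide)) (And.intro (E i k 1 0 h (by decide))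
      (And.intro (E i k 1 2 h (by decide)) (And.intro (E i k 2 0 h (by decide))
      (E i k 2 1 h (by decide))))))
    obtain ⟨a1, a2, a3, a4, a5, a6⟩ := e 0 1 (by decide)
    obtain ⟨b1, b2, b3, b4, b5, b6⟩ := e 0 2 (by decide)
    obtain ⟨c1, c2, c3, c4, c5, c6⟩ := e 1 2 (by decide)
    linear_combination (a1 + a2 + a3 + a4 + a5 + a6 + b1 + b2 + b3 + b4 + b5 + b6 +
      c1 + c2 + c3 + c4 + c5 + c6) / 2
  apply_fun exp at key
  simp only [Fin.sum_univ_three, exp_add] at key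
  simp only [hexpP 1 0 _ (by decide), hexpP 2 0 _ (by decide), hexpP 2 1 _ (by decide),
    hexpP 0 1 _ (by decide), hexpP 0 2 _ (by decide), hexpP 1 2 _ (by decide),
    hexpW 0 _ 1 (by decide), hexpW 0 _ 2 (by decide), hexpW 1 _ 0 (by decide),
    hexpW 1 _ 2 (by decide), hexpW 2 _ 0 (by decide), hexpW 2 _ 1 (by decide)] at key
  -- After exponentiation both sides have the same factors up to sign. Only the nine denominators `p
  -- i - p k` are reversed between the sides, an odd number, so the identity says `1 = -1`.
  have s1 : ∀ i k, p i - p k = -(p k - p i) := fun i k => by ring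
  have s2 : ∀ i k, p i - w k = -(w k - p i) := fun i k => by ring
  have s3 : ∀ i k, w i - w k = -(w k - w i) := fun i k => by ring
  rw [s1 0 1, s1 0 2, s1 1 2, s3 0 1, s3 0 2, s3 1 2] at key
  simp only [s2] at key
  have a1 := hpp 1 0 (by decide)
  have a2 := hpp 2 0 (by decide)
  have a3 := hpp 2 1 (by decide)
  have b1 := hww 1 0 (by decide)
  have b2 := hww 2 0 (by decide)
  have b3 := hww 2 1 (by decide)
  have c1 := hwp 0 0
  have c2 := hwp 0 1
  have c3 := hwp 0 2
  have d1 := hwp 1 0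
  have d2 := hwp 1 1
  have d3 := hwp 1 2
  have e1 := hwp 2 0
  have e2 := hwp 2 1
  have e3 := hwp 2 2
  generalize p 1 - p 0 = A1 at *
  generalize p 2 - p 0 = A2 at *
  generalize p 2 - p 1 = A3 at *
  generalize w 1 - w 0 = B1 at *
  generalize w 2 - w 0 = B2 at *
  generalize w 2 - w 1 = B3 at *
  generalize w 0 - p 0 = C1 at *
  generalize w 0 - p 1 = C2 at *
  generalize w 0 - p 2 = C3 at *
  generalize w 1 - p 0 = D1 at *
  generalize w 1 - p 1 = D2 at *
  generalize w 1 - p 2 = D3 at *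
  generalize w 2 - p 0 = E1 at *
  generalize w 2 - p 1 = E2 at *
  generalize w 2 - p 2 = E3 at *
  field_simp at key
  norm_num at key

end LogIncrement

/-- If two sets of three points of the plane are joined pairwise by connected pieces, then some two
pieces that belong to independent edges of `K₃,₃` meet. -/
theorem not_exists_joinedIn_K33 (p w : Fin 3 → EuclideanSpace ℝ (Fin 2))
    (S : Fin 3 → Fin 3 → Set (EuclideanSpace ℝ (Fin 2)))
    (hS : ∀ i j, JoinedIn (S i j) (p i) (w j))
    (hdisj : ∀ i k j l, i < k → j ≠ l → Disjoint (S i j) (S k l)) : False := by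
  let φ := Complex.orthonormalBasisOneI.repr.symm
  -- Outside `[0, 1]` the extended path rests at its ends, so it stays in `S i j` for all real `t`.
  have hmem : ∀ i j t, (hS i j).somePath.extend t ∈ S i j := fun i j t =>
    (hS i j).somePath_mem _
  refine not_exists_planar_K33 (fun i => φ (p i)) (fun i => φ (w i))
    (fun i j t => φ ((hS i j).somePath.extend t)) (fun i j => ?_) (fun i j => ?_) (fun i j => ?_) ?_
  · exact φ.continuous.comp (hS i j).somePath.continuous_extend
  · simp
  · simp
  · intro i k j l hik hjl s t h
    have h := φ.injective h
    rcases lt_or_gt_of_ne hik with hlt | hlt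
    · exact Set.disjoint_left.1 (hdisj i k j l hlt hjl) (hmem i j s) (h ▸ hmem k l t)
    · exact Set.disjoint_left.1 (hdisj k i l j hlt hjl.symm) (hmem k l t) (h ▸ hmem i j s)

/-! ### Subdrawings, and three branches reaching a common face. -/

namespace SimpleGraph

namespace PlaneDrawing

variable {V : Type*} {G : SimpleGraph V} (D : PlaneDrawing G)

/-- The part of the drawing that belongs to the subgraph induced by `C`. -/
def drawn (C : Set V) : Set (EuclideanSpace ℝ (Fin 2)) :=
  D.point '' C ∪ ⋃ e ∈ {e ∈ G.edgeSet | ∀ x ∈ e, x ∈ C}, D.arc e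

theorem point_mem_drawn {C : Set V} {x : V} (hx : x ∈ C) : D.point x ∈ D.drawn C :=
  Or.inl ⟨x, hx, rfl⟩

theorem arc_subset_drawn {C : Set V} {e : Sym2 V} (he : e ∈ G.edgeSet) (h : ∀ x ∈ e, x ∈ C) :
    D.arc e ⊆ D.drawn C := fun _ hz => Or.inr (Set.mem_biUnion (And.intro he h) hz)

theorem mem_drawn {C : Set V} {z : EuclideanSpace ℝ (Fin 2)} :
    z ∈ D.drawn C ↔ (∃ x ∈ C, D.point x = z) ∨
      ∃ e ∈ G.edgeSet, (∀ x ∈ e, x ∈ C) ∧ z ∈ D.arc e := by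
  simp [drawn, and_assoc]

theorem drawn_mono {C C' : Set V} (h : C ⊆ C') : D.drawn C ⊆ D.drawn C' := by
  intro z hz
  rw [mem_drawn] at hz ⊢
  rcases hz with ⟨x, hx, rfl⟩ | ⟨e, he, heC, hz⟩
  · exact Or.inl ⟨x, h hx, rfl⟩
  · exact Or.inr ⟨e, he, fun x hx => h (heC x hx), hz⟩

theorem drawn_subset_carrier (C : Set V) : D.drawn C ⊆ D.carrier := by
  intro z hz
  rw [mem_drawn] at hz
  rcases hz with ⟨x, hx, rfl⟩ | ⟨e, he, heC, hz⟩
  · exact Or.inl ⟨x, rfl⟩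
  · exact Or.inr (Set.mem_biUnion he hz)

theorem disjoint_drawn {C C' : Set V} (h : Disjoint C C') :
    Disjoint (D.drawn C) (D.drawn C') := by
  rw [Set.disjoint_left] at h ⊢
  intro z hz hz'
  rw [mem_drawn] at hz hz'
  rcases hz with ⟨x, hx, rfl⟩ | ⟨e, he, heC, hz⟩
  · rcases hz' with ⟨y, hy, hxy⟩ | ⟨e, he, heC, hz⟩
    · exact h hx (D.point_injective hxy ▸ hy)
    · exact h hx (heC x (D.mem_of_point_mem_arc e he x hz))
  · rcases hz' with ⟨y, hy, rfl⟩ | ⟨f, hf, hfC, hz'⟩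
    · exact h (heC y (D.mem_of_point_mem_arc e he y hz)) hy
    · have hef : e ≠ f := by
        rintro rfl
        induction e with
        | _ a b => exact h (heC a (by simp)) (hfC a (by simp))
      obtain ⟨x, hx, -⟩ := D.arc_inter_arc e he f hf hef ⟨hz, hz'⟩
      exact h (heC x hx.1) (hfC x hx.2)

theorem isCompact_arc {e : Sym2 V} (he : e ∈ G.edgeSet) : IsCompact (D.arc e) := by
  induction e with
  | _ a b =>
    obtain ⟨γ, hγ, -, -, -, hr⟩ := D.isArc a b he
    exact hr ▸ isCompact_range hγ

theorem isClosed_drawn [Finite V] (C : Set V) : IsClosed (D.drawn C) :=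
  ((Set.toFinite C).image D.point).isClosed.union
    ((Set.toFinite _).isClosed_biUnion fun _ he => (D.isCompact_arc he.1).isClosed)

theorem drawn_univ : D.drawn Set.univ = D.carrier := by
  simp [drawn, carrier]

theorem isClosed_carrier [Finite V] : IsClosed D.carrier :=
  D.drawn_univ ▸ D.isClosed_drawn _

theorem joinedIn_drawn_of_adj {C : Set V} {x y : V} (h : G.Adj x y) (hx : x ∈ C) (hy : y ∈ C) :
    JoinedIn (D.drawn C) (D.point x) (D.point y) := by
  obtain ⟨γ, hγ, -, h0, h1, hr⟩ := D.isArc x y h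
  refine ⟨⟨⟨γ, hγ⟩, h0, h1⟩, fun t => D.arc_subset_drawn (e := s(x, y)) h ?_ ?_⟩
  · simp [hx, hy]
  · exact hr ▸ Set.mem_range_self t

theorem joinedIn_drawn_of_reachable {C : Set V} {H : SimpleGraph V} {x y : V} (hx : x ∈ C)
    (hC : ∀ a ∈ C, ∀ b, H.Adj a b → G.Adj a b ∧ b ∈ C) (h : H.Reachable x y) :
    JoinedIn (D.drawn C) (D.point x) (D.point y) := by
  obtain ⟨p⟩ := h
  induction p with
  | nil => exact JoinedIn.refl (D.point_mem_drawn hx)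
  | cons hab p ih =>
    obtain ⟨h1, h2⟩ := hC _ hx _ hab
    exact (D.joinedIn_drawn_of_adj h1 hx h2).trans (ih h2)

/-- Three disjoint connected pieces that are attached to the same two vertices do not all reach
the boundary of a face. -/
theorem not_forall_mem_frontier_of_three_branches [Finite V] {F : Set (EuclideanSpace ℝ (Fin 2))}
    (hF : D.IsOuterFace F) {u v : V} (huv : u ≠ v) (w : Fin 3 → V) (C : Fin 3 → Set V)
    (hu : ∀ i, u ∉ C i) (hv : ∀ i, v ∉ C i) (hC : ∀ i j, i ≠ j → Disjoint (C i) (C j))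
    (hw : ∀ i, w i ∈ C i)
    (hju : ∀ i, JoinedIn (D.drawn (insert u (C i))) (D.point u) (D.point (w i)))
    (hjv : ∀ i, JoinedIn (D.drawn (insert v (C i))) (D.point v) (D.point (w i))) :
    ¬ ∀ i, D.point (w i) ∈ frontier F := by
  intro hfr
  obtain ⟨⟨z, hz, rfl⟩, -⟩ := hF
  set F := connectedComponentIn D.carrierᶜ z with hFdef
  have hFo : IsOpen F := D.isClosed_carrier.isOpen_compl.connectedComponentIn
  have hFp : IsPathConnected F :=
    hFo.isConnected_iff_isPathConnected.1 (isConnected_connectedComponentIn_iff.2 hz)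
  have hFc : ∀ A, Disjoint (D.drawn A) F := fun A => Set.disjoint_left.2 fun x hx hxF =>
    connectedComponentIn_subset _ _ hxF (D.drawn_subset_carrier A hx)
  -- The ball may meet the drawing of `C i` and its attaching edges, but nothing drawn entirely off
  -- `C i`.
  have hball : ∀ i, ∃ r > 0, Metric.ball (D.point (w i)) r ⊆ (D.drawn (C i)ᶜ)ᶜ := fun i =>
    Metric.isOpen_iff.1 (D.isClosed_drawn _).isOpen_compl _ fun h =>
      Set.disjoint_left.1 (D.disjoint_drawn disjoint_compl_right)
        (D.point_mem_drawn (hw i)) h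
  choose r hr hball using hball
  -- Travel inside `F` to a point near `w i`, then along a straight segment in the ball. No
  -- accessibility of boundary points by arcs of `F` is needed.
  have hz' : ∀ i, JoinedIn (F ∪ Metric.ball (D.point (w i)) (r i)) z (D.point (w i)) := by
    intro i
    obtain ⟨q, hq, hqF⟩ := mem_closure_iff.1 (frontier_subset_closure (hfr i)) _ Metric.isOpen_ball
      (Metric.mem_ball_self (hr i))
    refine ((hFp.joinedIn z (mem_connectedComponentIn hz) q hqF).mono Set.subset_union_left).trans
      ((JoinedIn.of_segment_subset ?_).mono Set.subset_union_right)
    exact (convex_ball _ _).segment_subset hq (Metric.mem_ball_self (hr i))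
  have hzd : ∀ i j x, i ≠ j → x ∉ C j →
      Disjoint (D.drawn (insert x (C i))) (F ∪ Metric.ball (D.point (w j)) (r j)) := by
    intro i j x hij hx
    refine Disjoint.union_right (hFc _) (Set.disjoint_left.2 fun y hy hy' => hball j hy' ?_)
    refine D.drawn_mono ?_ hy
    rw [Set.insert_subset_iff]
    exact ⟨hx, (hC i j hij).subset_compl_right⟩
  refine not_exists_joinedIn_K33 ![D.point u, D.point v, z] (fun i => D.point (w i))
    ![fun i => D.drawn (insert u (C i)), fun i => D.drawn (insert v (C i)),
      fun i => F ∪ Metric.ball (D.point (w i)) (r i)] ?_ ?_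
  · intro i j
    fin_cases i
    · exact hju j
    · exact hjv j
    · exact hz' j
  · intro i k j l hik hjl
    fin_cases i <;> fin_cases k <;> first | exact absurd hik (by decide) | skip
    · refine D.disjoint_drawn ?_
      simp [hu, hv, hC j l hjl, Ne.symm huv]
    · exact hzd _ _ _ hjl (hu _)
    · exact hzd _ _ _ hjl (hv _)

end PlaneDrawing

end SimpleGraph

/-! ### Separation by links, and outerplanarity bounding the number of bags. -/

namespace SimpleGraph

namespace TreeDecomposition

variable {V ι : Type*} {G : SimpleGraph V} (T : TreeDecomposition G ι)

/-- A vertex with bags on both sides of a link lies in both ends of the link. -/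
theorem mem_bag_of_not_reachable {i b a c : ι} {x : V}
    (h : ¬ (T.tree.deleteEdges {s(i, b)}).Reachable a c) (ha : x ∈ T.bag a) (hc : x ∈ T.bag c) :
    x ∈ T.bag i ∧ x ∈ T.bag b := by
  by_contra hx
  refine h ?_
  have hr := (T.subtree x).preconnected ⟨a, ha⟩ ⟨c, hc⟩
  refine hr.map (⟨Subtype.val, ?_⟩ : T.tree.induce {i | x ∈ T.bag i} →g _)
  rintro ⟨k, hk⟩ ⟨l, hl⟩ hkl
  rw [deleteEdges_adj]
  refine ⟨hkl, fun he => hx ?_⟩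
  rcases Sym2.eq_iff.1 he with ⟨rfl, rfl⟩ | ⟨rfl, rfl⟩
  · exact ⟨hk, hl⟩
  · exact ⟨hl, hk⟩

theorem not_reachable_deleteEdges {i b : ι} (h : T.tree.Adj i b) :
    ¬ (T.tree.deleteEdges {s(i, b)}).Reachable i b :=
  isBridge_iff.1 (isAcyclic_iff_forall_isBridge.1 T.isTree.isAcyclic h)

/-- Two bags that contain `u` and `v` are separated by a link both of whose ends contain
`u` and `v`. -/
theorem exists_link_of_mem_bag {i j : ι} (hij : i ≠ j) {u v : V} (hui : u ∈ T.bag i)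
    (hvi : v ∈ T.bag i) (huj : u ∈ T.bag j) (hvj : v ∈ T.bag j) :
    ∃ b, T.tree.Adj i b ∧ u ∈ T.bag b ∧ v ∈ T.bag b ∧
      ¬ (T.tree.deleteEdges {s(i, b)}).Reachable i j := by
  classical
  obtain ⟨p⟩ := T.isTree.connected.preconnected i j
  obtain ⟨p, hp⟩ := p.toPath
  cases p with
  | nil => exact absurd rfl hij
  | @cons _ b _ hib p =>
    rw [Walk.cons_isPath_iff] at hp
    have hbj : (T.tree.deleteEdges {s(i, b)}).Reachable b j :=
      reachable_deleteEdges_iff_exists_walk.2 ⟨p, fun h => hp.2 (p.fst_mem_support_of_mem_edges h)⟩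
    have hn : ¬ (T.tree.deleteEdges {s(i, b)}).Reachable i j := fun h =>
      T.not_reachable_deleteEdges hib (h.trans hbj.symm)
    exact ⟨b, hib, (T.mem_bag_of_not_reachable hn hui huj).2,
      (T.mem_bag_of_not_reachable hn hvi hvj).2, hn⟩

end TreeDecomposition

variable {V ι : Type*}

/-- The graph obtained from `G` by isolating `u` and `v`. -/
def isolate (G : SimpleGraph V) (u v : V) : SimpleGraph V where
  Adj x y := G.Adj x y ∧ (x ≠ u ∧ x ≠ v) ∧ (y ≠ u ∧ y ≠ v)
  symm := ⟨fun _ _ h => ⟨h.1.symm, h.2.2, h.2.1⟩⟩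
  loopless := ⟨fun x h => G.loopless.irrefl x h.1⟩

theorem isolate_comm (G : SimpleGraph V) (u v : V) : G.isolate u v = G.isolate v u := by
  ext x y
  simp only [isolate]
  tauto

theorem ne_of_reachable_isolate {G : SimpleGraph V} {u v x y : V}
    (h : (G.isolate u v).Reachable x y) (hx : x ≠ u ∧ x ≠ v) : y ≠ u ∧ y ≠ v := by
  obtain ⟨p⟩ := h
  induction p with
  | nil => exact hx
  | cons hab p ih => exact ih hab.2.2

/-- The separating link has label `{u, v}`, so the bags of any other vertex stay on one side of it.
Each edge avoiding `u` and `v` has a common bag, so a walk cannot change sides either. -/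
theorem TreeDecomposition.not_reachable_isolate [DecidableEq V] {G : SimpleGraph V}
    (T : TreeDecomposition G ι)
    (hT : ∀ i j, T.tree.Adj i j → (T.bag i ∩ T.bag j).card = 2) {i j : ι} (hij : i ≠ j)
    {u v x y : V} (huv : u ≠ v) (hui : u ∈ T.bag i) (hvi : v ∈ T.bag i) (huj : u ∈ T.bag j)
    (hvj : v ∈ T.bag j) (hxi : x ∈ T.bag i) (hyj : y ∈ T.bag j) (hx : x ≠ u ∧ x ≠ v) :
    ¬ (G.isolate u v).Reachable x y := by
  obtain ⟨b, hib, hub, hvb, hn⟩ := T.exists_link_of_mem_bag hij hui hvi huj hvj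
  have hinter : T.bag i ∩ T.bag b = {u, v} := by
    refine (Finset.eq_of_subset_of_card_le ?_ ?_).symm
    · simp [Finset.insert_subset_iff, *]
    · rw [hT i b hib, Finset.card_pair huv]
  have hside : ∀ a c z, z ≠ u ∧ z ≠ v → z ∈ T.bag a → z ∈ T.bag c →
      (T.tree.deleteEdges {s(i, b)}).Reachable a c := by
    intro a c z hz ha hc
    by_contra h
    have := Finset.mem_inter.2 (T.mem_bag_of_not_reachable h ha hc)
    rw [hinter] at this
    simp [hz] at this
  have main : ∀ x, (G.isolate u v).Reachable x y → ∀ a, x ≠ u ∧ x ≠ v → x ∈ T.bag a →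
      (T.tree.deleteEdges {s(i, b)}).Reachable a j := by
    rintro x ⟨p⟩
    induction p with
    | nil => exact fun a hx ha => hside a j _ hx ha hyj
    | cons hcd p ih =>
      intro a hc ha
      obtain ⟨k, hk, hk'⟩ := T.edge_cover _ _ hcd.1
      exact (hside a k _ hc ha hk).trans (ih hyj k hcd.2.2 hk')
  exact fun h => hn (main x h i hx hxi)

/-- Otherwise the component of `w` would be cut off from `u` by deleting `v` alone. -/
theorem IsKVertexConnected.exists_adj_reachable_isolate [Fintype V] {G : SimpleGraph V}
    (hG : G.IsKVertexConnected 2) {u v w : V} (huv : u ≠ v) (hw : w ≠ u ∧ w ≠ v) :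
    ∃ x, (G.isolate u v).Reachable w x ∧ G.Adj x u := by
  by_contra! hno
  have hcon := (hG.2 {v} (by simp)).preconnected ⟨w, by simp [hw]⟩ ⟨u, by simp [huv]⟩
  obtain ⟨p⟩ := hcon
  have : ∀ a b : ((({v} : Finset V) : Set V)ᶜ : Set V),
      (G.induce ((({v} : Finset V) : Set V)ᶜ)).Walk a b →
      (G.isolate u v).Reachable w a → (G.isolate u v).Reachable w b := by
    intro a b p
    induction p with
    | nil => exact id
    | @cons a c b hab p ih =>
      intro ha
      refine ih (ha.trans (Adj.reachable ⟨hab, ne_of_reachable_isolate ha hw, ?_, ?_⟩))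
      · intro hc
        exact hno a ha (hc ▸ hab)
      · simpa using c.2
  exact (ne_of_reachable_isolate (this _ _ p (Reachable.refl _)) hw).1 rfl

theorem PlaneDrawing.joinedIn_drawn_insert [Fintype V] {G : SimpleGraph V} (D : PlaneDrawing G)
    (hG : G.IsKVertexConnected 2) {u v w : V} (huv : u ≠ v) (hw : w ≠ u ∧ w ≠ v) :
    JoinedIn (D.drawn (insert u {x | (G.isolate u v).Reachable w x})) (D.point u) (D.point w) := by
  obtain ⟨x, hx, hxu⟩ := hG.exists_adj_reachable_isolate huv hw
  refine (D.joinedIn_drawn_of_adj hxu.symm (Set.mem_insert _ _) (Set.mem_insert_of_mem _ hx)).trans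
    ((D.joinedIn_drawn_of_reachable (H := G.isolate u v)
      (C := {x | (G.isolate u v).Reachable w x}) (Reachable.refl w) (fun a ha b hab => ⟨hab.1, ?_⟩) hx).symm.mono (D.drawn_mono (Set.subset_insert _ _)))
  exact Reachable.trans ha hab.reachable

theorem IsOuterplanar.ncard_le_two [Fintype V] [DecidableEq V] {G : SimpleGraph V}
    (hG : G.IsOuterplanar) (hconn : G.IsKVertexConnected 2) [Finite ι] (T : TreeDecomposition G ι)
    (hcard : ∀ i, (T.bag i).card = 3)
    (hT : ∀ i j, T.tree.Adj i j → (T.bag i ∩ T.bag j).card = 2) {u v : V} (huv : u ≠ v) :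
    {i : ι | u ∈ T.bag i ∧ v ∈ T.bag i}.ncard ≤ 2 := by
  by_contra! h
  obtain ⟨D, F, hF, hfr⟩ := hG
  obtain ⟨a, ha, b, hb, c, hc, hab, hac, hbc⟩ := (Set.two_lt_ncard).1 h
  have hthird : ∀ i, ∃ w ∈ T.bag i, w ≠ u ∧ w ≠ v := by
    intro i
    obtain ⟨w, hw, hw'⟩ := Finset.exists_mem_notMem_of_card_lt_card
      (s := {u, v}) (t := T.bag i) (by rw [hcard, Finset.card_pair huv]; norm_num)
    exact ⟨w, hw, by simpa using hw'⟩
  choose third hmem hne using hthird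
  let n : Fin 3 → ι := ![a, b, c]
  have hn : ∀ i j, i ≠ j → n i ≠ n j := by
    intro i j hij
    fin_cases i <;> fin_cases j <;> simp_all [n, Ne.symm]
  have hn' : ∀ i, u ∈ T.bag (n i) ∧ v ∈ T.bag (n i) := by
    intro i
    fin_cases i
    exacts [ha, hb, hc]
  refine D.not_forall_mem_frontier_of_three_branches hF huv (fun i => third (n i))
    (fun i => {x | (G.isolate u v).Reachable (third (n i)) x})
    (fun i hi => (ne_of_reachable_isolate hi (hne _)).1 rfl)
    (fun i hi => (ne_of_reachable_isolate hi (hne _)).2 rfl)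
    (fun i j hij => Set.disjoint_left.2 fun x hx hx' => ?_) (fun i => Reachable.refl _)
    (fun i => D.joinedIn_drawn_insert hconn huv (hne _)) (fun i => ?_) (fun i => hfr _)
  · exact T.not_reachable_isolate hT (hn i j hij) huv (hn' i).1 (hn' i).2 (hn' j).1 (hn' j).2
      (hmem _) (hmem _) (hne _) (Reachable.trans hx (Reachable.symm hx'))
  · rw [isolate_comm]
    exact D.joinedIn_drawn_insert hconn huv.symm (hne _).symm

end SimpleGraph

/-! ### Straight-line drawings on a parabola. -/

namespace SimpleGraph

section Parabola

variable {V : Type*} {f : V → ℝ}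

/-- The vertex `v`, placed on the parabola over `f v`. -/
noncomputable def parabolaPoint (f : V → ℝ) (v : V) : EuclideanSpace ℝ (Fin 2) :=
  !₂[f v, f v ^ 2]

theorem parabolaPoint_injective (hf : Function.Injective f) :
    Function.Injective (parabolaPoint f) := fun x y h =>
  hf (by simpa [parabolaPoint] using congrArg (fun z : EuclideanSpace ℝ (Fin 2) => z 0) h)

theorem eq_parabolaPoint {z : EuclideanSpace ℝ (Fin 2)} {a : V} (h0 : z 0 = f a)
    (h1 : z 1 = z 0 ^ 2) : parabolaPoint f a = z := by
  ext i
  fin_cases i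
  · simp [parabolaPoint, h0]
  · simp [parabolaPoint, h1, h0]

/-- The height of a chord above the parabola is a product vanishing only at the two ends; this one
formula controls all incidences. -/
theorem mem_segment_parabolaPoint {z : EuclideanSpace ℝ (Fin 2)} {a b : V} (hab : f a < f b)
    (hz : z ∈ segment ℝ (parabolaPoint f a) (parabolaPoint f b)) :
    f a ≤ z 0 ∧ z 0 ≤ f b ∧ z 1 - z 0 ^ 2 = (z 0 - f a) * (f b - z 0) := by
  obtain ⟨s, t, hs, ht, hst, rfl⟩ := hz
  obtain rfl : s = 1 - t := by linarith
  simp only [parabolaPoint, PiLp.add_apply, PiLp.smul_apply, smul_eq_mul,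
    Matrix.cons_val_zero, Matrix.cons_val_one]
  refine ⟨?_, ?_, by ring⟩ <;> nlinarith

/-- The straight-line drawing of `G` with its vertices on a parabola. -/
noncomputable def parabolaDrawing (G : SimpleGraph V) (hf : Function.Injective f)
    (hcross : ∀ a b c d, G.Adj a b → G.Adj c d → ¬ (f a < f c ∧ f c < f b ∧ f b < f d)) :
    PlaneDrawing G where
  point := parabolaPoint f
  point_injective := parabolaPoint_injective hf
  arc := Sym2.lift ⟨fun a b => segment ℝ (parabolaPoint f a) (parabolaPoint f b),
    fun _ _ => segment_symm _ _ _⟩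
  isArc := by
    intro u v h
    refine ⟨fun t => AffineMap.lineMap (parabolaPoint f u) (parabolaPoint f v) (t : ℝ), ?_, ?_, ?_,
      ?_, ?_⟩
    · exact AffineMap.lineMap_continuous.comp continuous_subtype_val
    · exact (AffineMap.lineMap_injective ℝ ((parabolaPoint_injective hf).ne h.ne)).comp
        Subtype.val_injective
    · simp
    · simp
    · simp only [Sym2.lift_mk, segment_eq_image_lineMap]
      ext z
      simp [unitInterval]
  mem_of_point_mem_arc := by
    have key : ∀ a b w, f a < f b →
        parabolaPoint f w ∈ segment ℝ (parabolaPoint f a) (parabolaPoint f b) → w = a ∨ w = b := by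
      intro a b w hab hw
      obtain ⟨-, -, h⟩ := mem_segment_parabolaPoint hab hw
      simp only [parabolaPoint, PiLp.toLp_apply, Matrix.cons_val_zero, Matrix.cons_val_one,
        sub_self, zero_eq_mul, sub_eq_zero] at h
      exact h.imp (fun h => hf h) (fun h => hf h.symm)
    intro e he w hw
    induction e with
    | _ a b =>
      rw [Sym2.mem_iff]
      rcases lt_or_gt_of_ne (hf.ne (G.ne_of_adj he)) with h | h
      · exact key a b w h hw
      · exact (key b a w h (by rw [segment_symm]; exact hw)).symm
  arc_inter_arc := by
    have hor : ∀ e ∈ G.edgeSet, ∃ a b, e = s(a, b) ∧ f a < f b ∧ G.Adj a b := by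
      intro e he
      induction e with
      | _ a b =>
        rcases lt_or_gt_of_ne (hf.ne (G.ne_of_adj he)) with h | h
        · exact ⟨a, b, rfl, h, he⟩
        · exact ⟨b, a, Sym2.eq_swap, h, Adj.symm he⟩
    -- Two chords of equal height at a common interior abscissa cannot be nested: if `a < c`, then
    -- `x - a` exceeds `x - c`, so `b - x` is less than `d - x`.
    have key : ∀ a b c d (x : ℝ), a < x → x < b → c < x → x < d →
        (x - a) * (b - x) = (x - c) * (d - x) → a < c → b < d := by
      intro a b c d x h1 h2 h3 h4 h h5
      by_contra! h6
      nlinarith [mul_pos (sub_pos.2 h5) (sub_pos.2 h2),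
        mul_nonneg (sub_pos.2 h3).le (sub_nonneg.2 h6)]
    rintro e he e' he' hne z ⟨hz, hz'⟩
    obtain ⟨a, b, rfl, hab, hadj⟩ := hor e he
    obtain ⟨c, d, rfl, hcd, hadj'⟩ := hor e' he'
    obtain ⟨h1, h2, h3⟩ := mem_segment_parabolaPoint hab hz
    obtain ⟨h1', h2', h3'⟩ := mem_segment_parabolaPoint hcd hz'
    have hmem : ∀ x, z 0 = f x → z 1 - z 0 ^ 2 = 0 → x ∈ s(a, b) → x ∈ s(c, d) →
        z ∈ parabolaPoint f '' {w | w ∈ s(a, b) ∧ w ∈ s(c, d)} := fun x hx h h' h'' =>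
      ⟨x, ⟨h', h''⟩, eq_parabolaPoint hx (by linarith)⟩
    by_cases h0 : z 1 - z 0 ^ 2 = 0
    · rw [h0, zero_eq_mul, sub_eq_zero, sub_eq_zero] at h3 h3'
      rcases h3 with h3 | h3 <;> rcases h3' with h3' | h3'
      · exact hmem a h3 h0 (by simp) (by simp [hf (h3.symm.trans h3')])
      · exact hmem a h3 h0 (by simp) (by simp [hf (h3.symm.trans h3'.symm)])
      · exact hmem b h3.symm h0 (by simp) (by simp [hf (h3.trans h3')])
      · exact hmem b h3.symm h0 (by simp) (by simp [hf (h3.trans h3'.symm)])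
    · exfalso
      have n1 := h3 ▸ h0
      have n2 := h3' ▸ h0
      simp only [mul_eq_zero, not_or, sub_eq_zero] at n1 n2
      have l1 := lt_of_le_of_ne h1 (Ne.symm n1.1)
      have l2 := lt_of_le_of_ne h2 (Ne.symm n1.2)
      have l3 := lt_of_le_of_ne h1' (Ne.symm n2.1)
      have l4 := lt_of_le_of_ne h2' (Ne.symm n2.2)
      have heq := h3.symm.trans h3'
      rcases lt_trichotomy (f a) (f c) with h | h | h
      · exact hcross a b c d hadj hadj'
          ⟨h, l3.trans l2, key _ _ _ _ _ l1 l2 l3 l4 heq h⟩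
      · rw [h, mul_right_inj' (sub_pos.2 l3).ne'] at heq
        exact hne (by rw [hf h, hf (by linarith : f b = f d)])
      · exact hcross c d a b hadj' hadj
          ⟨h, l1.trans l4, key _ _ _ _ _ l3 l4 l1 l2 heq.symm h⟩

theorem isOuterplanar_of_not_interleaving (G : SimpleGraph V) (hf : Function.Injective f)
    (hcross : ∀ a b c d, G.Adj a b → G.Adj c d → ¬ (f a < f c ∧ f c < f b ∧ f b < f d)) :
    G.IsOuterplanar := by
  let D := G.parabolaDrawing hf hcross
  -- For `x.2 > 0` this parametrises the region strictly below the parabola, which is connected,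
  -- unbounded and disjoint from the drawing; the vertices are limits as `x.2` tends to `0`.
  let g : ℝ × ℝ → EuclideanSpace ℝ (Fin 2) := fun x => !₂[x.1, x.1 ^ 2 - x.2]
  have hg : Continuous g := by
    refine (PiLp.continuous_toLp 2 _).comp (continuous_pi fun i => ?_)
    fin_cases i <;> simp <;> fun_prop
  let U := g '' (Set.univ ×ˢ Set.Ioi 0)
  have hUc : IsPreconnected U :=
    (isPreconnected_univ.prod isPreconnected_Ioi).image _ hg.continuousOn
  have hcar : ∀ z ∈ D.carrier, z 0 ^ 2 ≤ z 1 := by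
    have key : ∀ a b z, f a < f b →
        z ∈ segment ℝ (parabolaPoint f a) (parabolaPoint f b) → z 0 ^ 2 ≤ z 1 := by
      intro a b z hab hz
      obtain ⟨h1, h2, h3⟩ := mem_segment_parabolaPoint hab hz
      nlinarith [mul_nonneg (sub_nonneg.2 h1) (sub_nonneg.2 h2)]
    rintro z (⟨v, rfl⟩ | hz)
    · simp [D, parabolaDrawing, parabolaPoint]
    · obtain ⟨e, he, hz⟩ := Set.mem_iUnion₂.1 hz
      induction e with
      | _ a b =>
        rcases lt_or_gt_of_ne (hf.ne (G.ne_of_adj he)) with h | h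
        · exact key a b z h hz
        · exact key b a z h (by rw [segment_symm]; exact hz)
  have hU : U ⊆ D.carrierᶜ := by
    rintro _ ⟨⟨x, t⟩, ⟨-, ht⟩, rfl⟩ hz
    have := hcar _ hz
    simp only [g, Matrix.cons_val_zero, Matrix.cons_val_one] at this
    have : 0 < t := ht
    linarith
  have hp : g (0, 1) ∈ U := ⟨(0, 1), by simp, rfl⟩
  have hUF : U ⊆ connectedComponentIn D.carrierᶜ (g (0, 1)) :=
    hUc.subset_connectedComponentIn hp hU
  refine ⟨D, connectedComponentIn D.carrierᶜ (g (0, 1)), ⟨⟨_, hU hp, rfl⟩, fun hb => ?_⟩,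
    fun v => ⟨closure_mono hUF ?_, fun h => ?_⟩⟩
  · obtain ⟨R, hR⟩ := (hb.subset hUF).exists_norm_le
    have h1 := hR (g (0, |R| + 1)) ⟨_, by simp; positivity, rfl⟩
    have h2 := (PiLp.norm_apply_le (g (0, |R| + 1)) 1).trans h1
    have h3 : g (0, |R| + 1) 1 = -(|R| + 1) := by simp [g]
    rw [h3, Real.norm_eq_abs, abs_neg, abs_of_pos (by positivity)] at h2
    have := le_abs_self R
    linarith
  · refine image_closure_subset_closure_image hg ⟨(f v, 0), ?_, ?_⟩
    · simp [closure_prod_eq]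
    · simp [g, D, parabolaDrawing, parabolaPoint]
  · exact connectedComponentIn_subset _ _ (interior_subset h) (Or.inl ⟨v, rfl⟩)

end Parabola

end SimpleGraph

/-! ### Layouts on a line: `B` marks the free sides of the polygon. -/

/-- A placement of the points of `O` on a line in which no two related pairs interleave and every
pair in `B` is either consecutive or extremal. -/
structure IsLayout {V : Type*} (O : Set V) (R B : V → V → Prop) (f : V → ℝ) : Prop where
  injOn : Set.InjOn f O
  not_interleaving : ∀ a b c d, R a b → R c d → ¬ (f a < f c ∧ f c < f b ∧ f b < f d)
  consecutive_or_extremal : ∀ x y, B x y → f x < f y →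
    (∀ z ∈ O, f z ≤ f x ∨ f y ≤ f z) ∨ (∀ z ∈ O, f x ≤ f z ∧ f z ≤ f y)

/-- Being consecutive or extremal means being neighbours in the cyclic order, so `w` can be inserted
between `u` and `v`. The side `u v` then becomes interior, and the sides through `w` are free. -/
theorem IsLayout.exists_insert {V : Type*} {O : Set V} {R B R' B' : V → V → Prop}
    {f : V → ℝ} (h : IsLayout O R B f) {u v w : V} (hR : ∀ x y, R x y → x ∈ O ∧ y ∈ O)
    (hB : ∀ x y, B x y → x ∈ O ∧ y ∈ O) (hw : w ∉ O) (hu : u ∈ O) (hv : v ∈ O) (huv : u ≠ v)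
    (hRuv : R u v) (hRvu : R v u) (hBuv : B u v) (hBvu : B v u)
    (hR' : ∀ x y, R' x y → R x y ∨ ((x = u ∨ x = v ∨ x = w) ∧ (y = u ∨ y = v ∨ y = w)))
    (hB' : ∀ x y, B' x y → (B x y ∧ ¬ (x = u ∧ y = v) ∧ ¬ (x = v ∧ y = u)) ∨ x = y ∨
      (x = w ∧ (y = u ∨ y = v)) ∨ (y = w ∧ (x = u ∨ x = v))) :
    ∃ g, IsLayout (insert w O) R' B' g := by
  classical
  wlog hlt : f u < f v generalizing u v
  · refine this hv hu huv.symm hRvu hRuv hBvu hBuv (fun x y hxy => ?_) (fun x y hxy => ?_)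
      (lt_of_le_of_ne (not_lt.1 hlt) fun h' => huv (h.injOn hu hv h'.symm))
    · have := hR' x y hxy
      tauto
    · have := hB' x y hxy
      tauto
  -- The position of `w`: midway when `u`, `v` are consecutive, beyond `v` when they are the two
  -- extremes.
  obtain ⟨t, ht⟩ : ∃ t : ℝ, (f u < t ∧ t < f v ∧ ∀ z ∈ O, f z ≤ f u ∨ f v ≤ f z) ∨
      (f v < t ∧ ∀ z ∈ O, f u ≤ f z ∧ f z ≤ f v) := by
    rcases h.consecutive_or_extremal u v hBuv hlt with h' | h'
    · exact ⟨(f u + f v) / 2, Or.inl ⟨by linarith, by linarith, h'⟩⟩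
    · exact ⟨f v + 1, Or.inr ⟨by linarith, h'⟩⟩
  obtain ⟨g, hgO, hgw⟩ : ∃ g : V → ℝ, (∀ z ∈ O, g z = f z) ∧ g w = t :=
    ⟨Function.update f w t, fun z hz => Function.update_of_ne (ne_of_mem_of_not_mem hz hw) _ _,
      Function.update_self _ _ _⟩
  have hgu := hgO u hu
  have hgv := hgO v hv
  have hne : ∀ z ∈ O, f z ≠ t := by
    intro z hz hzt
    rcases ht with ⟨h1, h2, h3⟩ | ⟨h1, h3⟩
    · rcases h3 z hz with h | h <;> linarith
    · linarith [(h3 z hz).2]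
  refine ⟨g, ?_, ?_, ?_⟩
  · rintro x (rfl | hx) y (rfl | hy) hxy
    · rfl
    · exact absurd (by rw [← hgO y hy, ← hxy, hgw]) (hne y hy)
    · exact absurd (by rw [← hgO x hx, hxy, hgw]) (hne x hx)
    · exact h.injOn hx hy (by rw [← hgO x hx, ← hgO y hy, hxy])
  · have hnorm : ∀ x y, R' x y → g x < g y → (R x y ∧ g x = f x ∧ g y = f y ∧ x ∈ O ∧ y ∈ O) ∨
        (g x = f u ∧ g y = t) ∨ (g x = t ∧ g y = f v) ∨ (g x = f v ∧ g y = t) := by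
      intro x y hxy hlt'
      have hold : R x y → R x y ∧ g x = f x ∧ g y = f y ∧ x ∈ O ∧ y ∈ O := fun hr =>
        ⟨hr, hgO x (hR x y hr).1, hgO y (hR x y hr).2, hR x y hr⟩
      rcases hR' x y hxy with hr | ⟨rfl | rfl | rfl, rfl | rfl | rfl⟩
      · exact Or.inl (hold hr)
      · exact absurd hlt' (lt_irrefl _)
      · exact Or.inl (hold hRuv)
      · exact Or.inr (Or.inl ⟨hgu, hgw⟩)
      · exact Or.inl (hold hRvu)
      · exact absurd hlt' (lt_irrefl _)
      · exact Or.inr (Or.inr (Or.inr ⟨hgv, hgw⟩))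
      · exfalso
        rcases ht with ⟨h1, h2, h3⟩ | ⟨h1, h3⟩ <;> linarith
      · exact Or.inr (Or.inr (Or.inl ⟨hgw, hgv⟩))
      · exact absurd hlt' (lt_irrefl _)
    rintro a b c d hab hcd ⟨h1, h2, h3⟩
    rcases hnorm a b hab (h1.trans h2) with ⟨r1, a1, a2, m1, m2⟩ | ⟨a1, a2⟩ | ⟨a1, a2⟩ | ⟨a1, a2⟩ <;>
    rcases hnorm c d hcd (h2.trans h3) with ⟨r2, b1, b2, n1, n2⟩ | ⟨b1, b2⟩ | ⟨b1, b2⟩ | ⟨b1, b2⟩ <;>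
    rw [a1, b1] at h1 <;> rw [b1, a2] at h2 <;> rw [a2, b2] at h3
    · exact h.not_interleaving a b c d r1 r2 ⟨h1, h2, h3⟩
    all_goals
      rcases ht with ⟨t1, t2, t3⟩ | ⟨t1, t3⟩
      all_goals first
        | linarith
        | (rcases t3 b m2 with t4 | t4 <;> linarith)
        | (rcases t3 c n1 with t4 | t4 <;> linarith)
        | linarith [(t3 a m1).1, (t3 b m2).2]
        | linarith [(t3 c n1).1, (t3 d n2).2]
  · intro x y hxy hlt'
    rcases hB' x y hxy with ⟨hb, hn1, hn2⟩ | rfl | ⟨rfl, rfl | rfl⟩ | ⟨rfl, rfl | rfl⟩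
    · obtain ⟨hx, hy⟩ := hB x y hb
      rw [hgO x hx, hgO y hy] at hlt' ⊢
      rcases h.consecutive_or_extremal x y hb hlt' with h' | h'
      · left
        rintro z (rfl | hz)
        · rw [hgw]
          -- If `w` fell strictly between consecutive `x` and `y`, these would have to be `u` and
          -- `v`, a pair no longer free.
          by_contra! hc
          rcases ht with ⟨t1, t2, t3⟩ | ⟨t1, t3⟩
          · have e1 : f x = f u := by
              rcases h' u hu with h4 | h4
              · rcases t3 x hx with h5 | h5 <;> linarith
              · linarith
            have e2 : f y = f v := by
              rcases h' v hv with h4 | h4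
              · linarith
              · rcases t3 y hy with h5 | h5 <;> linarith
            exact hn1 ⟨h.injOn hx hu e1, h.injOn hy hv e2⟩
          · linarith [(t3 y hy).2]
        · rw [hgO z hz]
          exact h' z hz
      · right
        rintro z (rfl | hz)
        · rw [hgw]
          rcases ht with ⟨t1, t2, t3⟩ | ⟨t1, t3⟩
          · exact ⟨by linarith [(h' u hu).1], by linarith [(h' v hv).2]⟩
          · exact absurd ⟨h.injOn hx hu (le_antisymm (h' u hu).1 (t3 x hx).1),
              h.injOn hy hv (le_antisymm (t3 y hy).2 (h' v hv).2)⟩ hn1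
        · rw [hgO z hz]
          exact h' z hz
    · exact absurd hlt' (lt_irrefl _)
    · exfalso
      rcases ht with ⟨t1, t2, t3⟩ | ⟨t1, t3⟩ <;> linarith
    · rcases ht with ⟨t1, t2, t3⟩ | ⟨t1, t3⟩
      · left
        rintro z (rfl | hz)
        · exact Or.inl le_rfl
        · rw [hgw, hgv, hgO z hz]
          exact (t3 z hz).imp (fun h => h.trans t1.le) id
      · linarith
    · rcases ht with ⟨t1, t2, t3⟩ | ⟨t1, t3⟩
      · left
        rintro z (rfl | hz)
        · exact Or.inr le_rfl
        · rw [hgw, hgu, hgO z hz]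
          exact (t3 z hz).imp id (fun h => t2.le.trans h)
      · right
        rintro z (rfl | hz)
        · exact ⟨hlt'.le, le_rfl⟩
        · rw [hgw, hgu, hgO z hz]
          exact ⟨(t3 z hz).1, by linarith [(t3 z hz).2]⟩
    · rcases ht with ⟨t1, t2, t3⟩ | ⟨t1, t3⟩
      · linarith
      · left
        rintro z (rfl | hz)
        · exact Or.inr le_rfl
        · rw [hgv, hgO z hz]
          exact Or.inl (t3 z hz).2

/-! ### Building the layout outwards from the root. -/

namespace SimpleGraph.RootedTreeDecomposition

variable {V ι : Type*} {G : SimpleGraph V}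

/-- The set of nodes `S` contains a father of each of its members other than the root. -/
def IsRootClosed (T : RootedTreeDecomposition G ι) (S : Finset ι) : Prop :=
  ∀ a ∈ S, a ≠ T.root → ∃ b ∈ S, T.IsLink b a

theorem exists_isLink (T : RootedTreeDecomposition G ι) {a : ι} (ha : a ≠ T.root) :
    ∃ b, T.IsLink b a := by
  obtain ⟨p, hp⟩ := (T.isTree.connected.preconnected a T.root).exists_walk_length_eq_dist
  cases p with
  | nil => exact absurd rfl ha
  | @cons _ b _ hab p =>
    refine ⟨b, hab.symm, ?_⟩
    rw [dist_comm, dist_comm (u := T.root), ← hp, Walk.length_cons]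
    exact Nat.lt_succ_of_le (dist_le p)

/-- Climbing through fathers inside `S` ends at the root and never uses a link at `a`, which is
outside `S`. -/
theorem IsRootClosed.reachable {T : RootedTreeDecomposition G ι} {S : Finset ι}
    (hS : T.IsRootClosed S) {a b c : ι} (ha : a ∉ S) (hc : c ∈ S) :
    (T.tree.deleteEdges {s(a, b)}).Reachable c T.root := by
  induction hn : T.tree.dist T.root c using Nat.strong_induction_on generalizing c with
  | _ n ih =>
    by_cases hroot : c = T.root
    · exact hroot ▸ Reachable.refl _
    · obtain ⟨d, hd, hdc⟩ := hS c hc hroot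
      refine Reachable.trans (Adj.reachable ?_) (ih _ (hn ▸ hdc.2) hd rfl)
      rw [deleteEdges_adj]
      refine ⟨hdc.1.symm, fun he => ha ?_⟩
      rcases Sym2.eq_iff.1 he with ⟨rfl, rfl⟩ | ⟨rfl, rfl⟩
      exacts [hc, hd]

/-- If every pair of vertices lies in at most two bags, then the vertices that occur in a
root-closed set of nodes have a layout. -/
theorem exists_isLayout [Fintype V] [DecidableEq V] [Finite ι] (T : RootedTreeDecomposition G ι)
    (hcard : ∀ i, (T.bag i).card = 3)
    (hT : ∀ i j, T.tree.Adj i j → (T.bag i ∩ T.bag j).card = 2)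
    (htwo : ∀ u v : V, u ≠ v → {i : ι | u ∈ T.bag i ∧ v ∈ T.bag i}.ncard ≤ 2)
    (S : Finset ι) (hS : T.IsRootClosed S) :
    ∃ f : V → ℝ, IsLayout {z | ∃ i ∈ S, z ∈ T.bag i} (fun x y => ∃ i ∈ S, x ∈ T.bag i ∧ y ∈ T.bag i)
      (fun x y => ∃ i ∈ S, x ∈ T.bag i ∧ y ∈ T.bag i ∧
        ∀ j ∈ S, x ∈ T.bag j → y ∈ T.bag j → j = i) f := by
  classical
  induction S using Finset.induction_on_max_value (fun i => T.tree.dist T.root i) with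
  | empty => exact ⟨0, ⟨by simp, by simp, by simp⟩⟩
  | insert a S haS hmax ih =>
    by_cases haroot : a = T.root
    · have hSe : S = ∅ := by
        refine Finset.eq_empty_of_forall_notMem fun x hx => haS ?_
        have := hmax x hx
        rw [haroot, dist_self, Nat.le_zero,
          T.isTree.connected.dist_eq_zero_iff] at this
        rwa [haroot, this]
      subst hSe
      obtain ⟨n, ⟨e⟩⟩ := Finite.exists_equiv_fin V
      have hinj : Function.Injective fun x => ((e x : ℕ) : ℝ) := fun x y h =>
        e.injective (Fin.ext (Nat.cast_injective h))
      refine ⟨fun x => ((e x : ℕ) : ℝ), ?_⟩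
      generalize (fun x => ((e x : ℕ) : ℝ)) = f at hinj
      -- At the root alone any injective placement works: a violation of either layout condition
      -- would need four distinct vertices in a bag of three.
      have hfour : ∀ p ∈ T.bag a, ∀ q ∈ T.bag a, ∀ r ∈ T.bag a, ∀ s ∈ T.bag a,
          f p < f q → f q < f r → f r < f s → False := by
        intro p hp q hq r hr s hs h1 h2 h3
        have hsub : ({p, q, r, s} : Finset V) ⊆ T.bag a := by
          simp only [Finset.insert_subset_iff, Finset.singleton_subset_iff]
          exact ⟨hp, hq, hr, hs⟩
        have := Finset.card_le_card hsub
        rw [hcard, Finset.card_insert_of_notMem, Finset.card_insert_of_notMem,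
          Finset.card_insert_of_notMem, Finset.card_singleton] at this
        · omega
        · simp only [Finset.mem_singleton]
          rintro rfl
          linarith
        · simp only [Finset.mem_insert, Finset.mem_singleton]
          rintro (rfl | rfl) <;> linarith
        · simp only [Finset.mem_insert, Finset.mem_singleton]
          rintro (rfl | rfl | rfl) <;> linarith
      refine ⟨hinj.injOn, ?_, ?_⟩
      · simp only [insert_empty_eq, Finset.mem_singleton, exists_eq_left]
        rintro p r q s ⟨hp, hr⟩ ⟨hq, hs⟩ ⟨h1, h2, h3⟩
        exact hfour p hp q hq r hr s hs h1 h2 h3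
      · simp only [insert_empty_eq, Finset.mem_singleton, exists_eq_left, Set.mem_ofPred_eq]
        rintro x y ⟨hx, hy, -⟩ hxy
        by_contra! hcon
        obtain ⟨⟨z, hz, hz1, hz2⟩, z', hz', hz3⟩ := hcon
        rcases lt_or_ge (f z') (f x) with h | h
        · exact hfour z' hz' x hx z hz y hy h hz1 hz2
        · exact hfour x hx z hz y hy z' hz' hz1 hz2 (hz3 h)
    · have hSc : T.IsRootClosed S := by
        intro x hx hxr
        obtain ⟨b, hb, hbx⟩ := hS x (Finset.mem_insert_of_mem hx) hxr
        refine ⟨b, (Finset.mem_insert.1 hb).resolve_left ?_, hbx⟩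
        rintro rfl
        exact absurd hbx.2 (not_lt.2 (hmax x hx))
      obtain ⟨f, hf⟩ := ih hSc
      obtain ⟨b, hb, hba⟩ := hS a (Finset.mem_insert_self _ _) haroot
      have hbS : b ∈ S := (Finset.mem_insert.1 hb).resolve_left hba.1.ne
      obtain ⟨u, v, huv, hinter⟩ := Finset.card_eq_two.1 (hT a b hba.1.symm)
      have hu : u ∈ T.bag a ∧ u ∈ T.bag b := Finset.mem_inter.1 (by simp [hinter])
      have hv : v ∈ T.bag a ∧ v ∈ T.bag b := Finset.mem_inter.1 (by simp [hinter])
      obtain ⟨w, hwa, hw⟩ := Finset.exists_mem_notMem_of_card_lt_card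
        (s := {u, v}) (t := T.bag a) (by rw [hcard, Finset.card_pair huv]; norm_num)
      simp only [Finset.mem_insert, Finset.mem_singleton, not_or] at hw
      have hbag : ∀ x ∈ T.bag a, x = u ∨ x = v ∨ x = w := by
        have : ({u, v, w} : Finset V) = T.bag a := by
          refine Finset.eq_of_subset_of_card_le (by simp [Finset.insert_subset_iff, *]) ?_
          rw [hcard, Finset.card_eq_three.2 ⟨u, v, w, huv, Ne.symm hw.1, Ne.symm hw.2, rfl⟩]
        intro x hx
        simpa [← this] using hx
      -- Deleting the link from `a` to its father separates `a` from `S`, so a vertex of `a` also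
      -- found in `S` belongs to the label `{u, v}`.
      have hwS : ∀ c ∈ S, w ∉ T.bag c := by
        intro c hc hwc
        have hn : ¬ (T.tree.deleteEdges {s(a, b)}).Reachable a c := fun h =>
          T.not_reachable_deleteEdges hba.1.symm
            ((h.trans (hSc.reachable haS hc)).trans (hSc.reachable haS hbS).symm)
        have := Finset.mem_inter.2 (T.mem_bag_of_not_reachable hn hwa hwc)
        simp [hinter, hw] at this
      -- Here the bound of two enters: `a` and `b` already contain `u` and `v`, so within `S` the
      -- pair is a free side.
      have huniq : ∀ j ∈ S, u ∈ T.bag j → v ∈ T.bag j → j = b := by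
        intro j hj huj hvj
        by_contra hjb
        refine absurd (htwo u v huv) (not_le.2 ((Set.two_lt_ncard).2
          ⟨a, ⟨hu.1, hv.1⟩, b, ⟨hu.2, hv.2⟩, j, ⟨huj, hvj⟩, hba.1.ne', ?_, Ne.symm hjb⟩))
        rintro rfl
        exact haS hj
      have hins := hf.exists_insert (u := u) (v := v) (w := w)
        (R' := fun x y => ∃ i ∈ insert a S, x ∈ T.bag i ∧ y ∈ T.bag i)
        (B' := fun x y => ∃ i ∈ insert a S, x ∈ T.bag i ∧ y ∈ T.bag i ∧
          ∀ j ∈ insert a S, x ∈ T.bag j → y ∈ T.bag j → j = i)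
        (fun x y ⟨i, hi, hx, hy⟩ => ⟨⟨i, hi, hx⟩, ⟨i, hi, hy⟩⟩)
        (fun x y ⟨i, hi, hx, hy, _⟩ => ⟨⟨i, hi, hx⟩, ⟨i, hi, hy⟩⟩)
        (fun ⟨i, hi, hwi⟩ => hwS i hi hwi) ⟨b, hbS, hu.2⟩ ⟨b, hbS, hv.2⟩ huv
        ⟨b, hbS, hu.2, hv.2⟩ ⟨b, hbS, hv.2, hu.2⟩ ⟨b, hbS, hu.2, hv.2, huniq⟩
        ⟨b, hbS, hv.2, hu.2, fun j hj h1 h2 => huniq j hj h2 h1⟩ ?_ ?_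
      · convert hins using 3
        ext z
        simp only [Finset.exists_mem_insert, Set.mem_ofPred_eq, Set.mem_insert_iff]
        constructor
        · rintro (hz | hz)
          · rcases hbag z hz with rfl | rfl | rfl
            · exact Or.inr ⟨b, hbS, hu.2⟩
            · exact Or.inr ⟨b, hbS, hv.2⟩
            · exact Or.inl rfl
          · exact Or.inr hz
        · rintro (rfl | hz)
          · exact Or.inl hwa
          · exact Or.inr hz
      · rintro x y ⟨i, hi, hx, hy⟩
        rcases Finset.mem_insert.1 hi with rfl | hi
        · exact Or.inr ⟨hbag x hx, hbag y hy⟩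
        · exact Or.inl ⟨i, hi, hx, hy⟩
      · rintro x y ⟨i, hi, hx, hy, hu'⟩
        -- Once `a` is added, `u` and `v` share both bags `a` and `b`, so their side is used up.
        have hpair : ¬ (u ∈ T.bag i ∧ v ∈ T.bag i ∧ ∀ j ∈ insert a S,
            u ∈ T.bag j → v ∈ T.bag j → j = i) := by
          rintro ⟨-, -, h⟩
          exact hba.1.ne ((h b hb hu.2 hv.2).trans
            (h a (Finset.mem_insert_self _ _) hu.1 hv.1).symm)
        have h1 : ¬ (x = u ∧ y = v) := by
          rintro ⟨rfl, rfl⟩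
          exact hpair ⟨hx, hy, hu'⟩
        have h2 : ¬ (x = v ∧ y = u) := by
          rintro ⟨rfl, rfl⟩
          exact hpair ⟨hy, hx, fun j hj h1 h2 => hu' j hj h2 h1⟩
        rcases Finset.mem_insert.1 hi with rfl | hi
        · right
          have := hbag x hx
          have := hbag y hy
          grind
        · exact Or.inl ⟨⟨i, hi, hx, hy, fun j hj => hu' j (Finset.mem_insert_of_mem hj)⟩, h1, h2⟩

end SimpleGraph.RootedTreeDecomposition

theorem mainTheorem7 {V : Type*} [Fintype V] [DecidableEq V] (G : SimpleGraph V)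
    (hconn : G.IsKVertexConnected 2) (hpartial : G.IsPartialKTree 2)
    {ι : Type*} [Fintype ι] (T : G.RootedTreeDecomposition ι) (hT : T.IsSuitable) :
    G.IsOuterplanar ↔
      ∀ u v : V, u ≠ v → {i : ι | u ∈ T.bag i ∧ v ∈ T.bag i}.ncard ≤ 2 := by
  constructor
  · intro h u v huv
    exact h.ncard_le_two hconn T.toTreeDecomposition hT.card_bag hT.card_inter huv
  · intro h
    obtain ⟨f, hf⟩ := T.exists_isLayout hT.card_bag hT.card_inter h Finset.univ
      (fun a _ ha => (T.exists_isLink ha).imp fun b hb => ⟨Finset.mem_univ b, hb⟩)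
    refine G.isOuterplanar_of_not_interleaving (f := f) (fun x y hxy => ?_) ?_
    · obtain ⟨i, hi⟩ := T.cover x
      obtain ⟨j, hj⟩ := T.cover y
      exact hf.injOn ⟨i, Finset.mem_univ i, hi⟩ ⟨j, Finset.mem_univ j, hj⟩ hxy
    · intro a b c d hab hcd
      obtain ⟨i, hi⟩ := T.edge_cover a b hab
      obtain ⟨j, hj⟩ := T.edge_cover c d hcd
      exact hf.not_interleaving a b c d ⟨i, Finset.mem_univ i, hi⟩ ⟨j, Finset.mem_univ j, hj⟩
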